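/- **Theorem (PBFT refines a composition of independent QTree instances).** *QTree.* A QTree state is a rooted tree of nodes, each with a round number in $\mathbb N$ (which identifies the node), a value, a parent and a status ADDED, GHOST or COMMITTED; initially it holds only $Root$ (round $0$, COMMITTED, no value, its own parent). A node *extends* another one if a (possibly empty) path of parent links leads from the first to the second; two nodes *conflict* if neither extends the other. $\mathit{add}(r,v,r_p)$, with $r>0$, returns OK iff there is a node $p$ of round $r_p<r$, there is no node of round $r$, the new node $n=(r,v,p)$ extends the COMMITTED node of highest round or $r$ is smaller than the round of that node, and $v$ is the value of $p$ unless $p=Root$. In this case it inserts $n$, with status GHOST if a node of round $>r$ exists and ADDED otherwise, and sets the status of every node of round $<r$ that conflicts with $n$ to GHOST. $\mathit{commit}(r)$ returns OK iff the node of round $r$ exists and is ADDED, and then makes it COMMITTED. Otherwise these methods return FAIL and change nothing. The *composition* of independent instances has one instance per sequence number $sn\in\mathbb N$; its actions are the invocations $sn.\mathit{add}(r,v,r_p)\Rightarrow ret$ and $sn.\mathit{commit}(r)\Rightarrow ret$, which act on instance $sn$ only. *PBFT.* There are $3f+1$ processes, at most $f$ of them faulty (Byzantine); a *quorum* is a set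 of at least $2f+1$ processes; every round $r\ge 1$ has a fixed leader. Messages are signed, and may be delayed, reordered, duplicated or lost. All processes start in round $1$. The content of a PROPOSE, JOIN or VOTE message consists of a round $r$, a sequence number $sn$, a value $v$ and a source round $r'$ (the round of the VOTE selected by the leader, $0$ if none). Correct processes act as follows. * ROUND-CHANGE. At any time a process $p$ in round $r-1$ may move to round $r$ and send ROUND-CHANGE$(r)$. For each $sn$ this message reports the VOTE of highest round that $p$ has sent for $sn$, with its certificate, or that $p$ has sent none; it may leave out (not report on) any $sn$ for which $p$ has received VOTE messages with the same content from a quorum. * PROPOSE. The leader of round $r$ sends a PROPOSE$(r,sn)$ message with $v$, $r'$ and, as a certificate, ROUND-CHANGE messages it has received, provided the selection is *correct*: either $r=1$ and $r'=0$; or $r>1$, the certificate consists of ROUND-CHANGE$(r)$ messages that report on $sn$ and come from a quorum, and either no valid VOTE is reported for $sn$ and $r'=0$ ($v$ is then arbitrary), or $r'$ is the highest round of the valid VOTE messages reported for $sn$ and $v$ is the value of one of them of round $r'$. A reported VOTE is valid if it is for $sn$, signed by the sender of the ROUND-CHANGE message, from a round $<r$, and certified by JOIN messages with the same content from a quorum.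 * JOIN. A process in round $r$ that has received from the leader of $r$ a correctly selected PROPOSE$(r,sn)$, and has not yet sent a JOIN$(r,sn)$, may send a JOIN$(r,sn)$ with the same content. * VOTE. A process in round $r$ that has received a PROPOSE$(r,sn)$ from the leader and JOIN$(r,sn)$ messages with the same content from a quorum may send a VOTE$(r,sn)$ with this content, and with these JOIN messages as a certificate. * DECIDE. A process in round $r$ that has received a PROPOSE$(r,sn)$ from the leader, a quorum of JOIN$(r,sn)$ and a quorum of VOTE$(r,sn)$ messages, all with the same content, may decide the value of this content for $sn$. A faulty process may at any time send any message under its own signature, where every signed message carried in a certificate must have been received by it before (signatures cannot be forged), and may claim to decide anything. *Linearization points.* A VOTE$(r,sn)$ sent by a process $p$ is *honest* if $p$ has already received JOIN$(r,sn)$ messages with the same content from a quorum; a decision of $p$ for $r$ and $sn$ is *honest* if $p$ has already received a quorum of JOIN$(r,sn)$ and a quorum of VOTE$(r,sn)$ messages with the same content. Along an execution, $sn.\mathit{add}(r,v,r')\Rightarrow OK$ is linearized at the first honest VOTE$(r,sn)$, where $v$ and $r'$ are the value and the source round of this message, and $sn.\mathit{commit}(r)\Rightarrow OK$ is linearized at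 the first honest decision for $r$ and $sn$. *Claim.* For every $f$, every set of at most $f$ faulty processes, every assignment of leaders to rounds and every set of values: 1. PBFT refines the composition of independent QTree instances: for every (finite) execution of PBFT, the sequence of invocations in the order of their linearization points is a trace of the composition from its initial state; in particular every invocation indeed returns OK. 2. For every execution and every $sn$, the sequence $\sigma$ of the invocations linearized on instance $sn$ satisfies: (i) for every $r$, $\sigma$ contains at most one $\mathit{add}(r,\_,\_)$ and at most one $\mathit{commit}(r)$; (ii) every $\mathit{commit}(r)$ is preceded by an $\mathit{add}(r,\_,\_)$; (iii) every $\mathit{add}(r,v,r_p)$ with $r_p>0$ is preceded by an $\mathit{add}(r_p,v',\_)$, where $0<r_p<r$ and $v=v'$; (iv) if $\sigma$ contains $\mathit{add}(r,\_,\_)$ and $\mathit{add}(r',\_,r'')$ with $r''<r<r'$, then $\sigma$ does not contain $\mathit{commit}(r)$. 3. In every execution, all honest VOTE$(r,sn)$ messages and all honest decisions for $r$ and $sn$ have the same content, so that linearizing at the first of them is unambiguous. -/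

import Mathlib

/-! ## Labeled transition systems and refinement -/

/-- A labeled transition system with states `Q`, transition labels `A` and one initial state. -/
structure LTS (Q A : Type*) where
  init : Q
  Tr : Q → A → Q → Prop

/-- `L.Execution E q`: the finite sequence `E = [(q₀, a₀), …, (qₙ₋₁, aₙ₋₁)]`, followed by `q`,
is an execution `q₀, a₀, q₁, a₁, …, qₙ = q` from the initial state `q₀ = L.init`. -/
inductive LTS.Execution {Q A : Type*} (L : LTS Q A) : List (Q × A) → Q → Prop
  | nil : L.Execution [] L.init
  | snoc {E : List (Q × A)} {q q' : Q} {a : A} :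
      L.Execution E q → L.Tr q a q' → L.Execution (E ++ [(q, a)]) q'

/-- The traces of `L`: the sequences of actions of its executions. -/
def LTS.traces {Q A : Type*} (L : LTS Q A) : Set (List A) :=
  {t | ∃ E q, L.Execution E q ∧ E.map Prod.snd = t}

/-- `L` refines `L'` through `Γ`, where `Γ` maps an execution of `L` to the sequence of actions
of `L'` marked along it: each of these sequences is a trace of `L'`. -/
def LTS.Refines {Q A Q' A' : Type*} (L : LTS Q A) (L' : LTS Q' A')
    (Γ : List (Q × A) → List A') : Prop :=
  ∀ E q, L.Execution E q → Γ E ∈ L'.traces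

/-! ## The QTree object -/

namespace QTree

inductive Status
  | added
  | ghost
  | committed

/-- A node of the tree. Its round is the key under which it is stored; `parent` is the round of
its parent; `value` is `none` only for the root. -/
structure Node (V : Type*) where
  value : Option V
  parent : ℕ
  status : Status

/-- A tree state: the node of each round, if there is one. (Round numbers identify nodes.) -/
abbrev Tree (V : Type*) := ℕ → Option (Node V)

/-- The initial state holds only the root: round 0, committed, and its own parent. -/
def initial (V : Type*) : Tree V :=
  fun r => if r = 0 then some ⟨none, 0, Status.committed⟩ else none

variable {V : Type*}

/-- The node of round `b` is the parent of the node of round `a`. -/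
def HasParent (q : Tree V) (a b : ℕ) : Prop := ∃ n, q a = some n ∧ n.parent = b

/-- There is a (possibly empty) path of parent links from round `a` down to round `b`. -/
def Extends (q : Tree V) (a b : ℕ) : Prop := Relation.ReflTransGen (HasParent q) a b

/-- Two nodes conflict when no path leads from one of them to the other. -/
def Conflicting (q : Tree V) (a b : ℕ) : Prop := ¬ Extends q a b ∧ ¬ Extends q b a

/-- The node of round `m` is the committed node of highest round. -/
def MaxCommitted (q : Tree V) (m : ℕ) : Prop :=
  (∃ n, q m = some n ∧ n.status = Status.committed) ∧
  ∀ k n, q k = some n → n.status = Status.committed → k ≤ m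

/-- The parent is in the tree and has a smaller round. -/
def Link (q : Tree V) (r rp : ℕ) : Prop := (q rp).isSome ∧ rp < r

/-- No node of the tree has round `r`. -/
def NewRound (q : Tree V) (r : ℕ) : Prop := q r = none

/-- The new node of round `r` under the parent `rp` extends the last committed node, or has a
smaller round. (The new node extends an existing node exactly if its parent does.) -/
def ExtendsTrunk (q : Tree V) (r rp : ℕ) : Prop :=
  ∃ m, MaxCommitted q m ∧ (Extends q rp m ∨ r < m)

/-- The new node has the value of its parent, unless the parent is the root. -/
def ValueConstraint (q : Tree V) (v : V) (rp : ℕ) : Prop :=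
  rp ≠ 0 → ∃ n, q rp = some n ∧ n.value = some v

def CanAdd (q : Tree V) (r : ℕ) (v : V) (rp : ℕ) : Prop :=
  0 < r ∧ Link q r rp ∧ NewRound q r ∧ ExtendsTrunk q r rp ∧ ValueConstraint q v rp

open Classical in
/-- Insert the new node, as a ghost if a node of higher round exists and as added otherwise. -/
noncomputable def insertNode (q : Tree V) (r : ℕ) (v : V) (rp : ℕ) : Tree V :=
  Function.update q r
    (some ⟨some v, rp, if ∃ k, r < k ∧ (q k).isSome then Status.ghost else Status.added⟩)

open Classical in
/-- Turn into ghosts all nodes of round smaller than `r` that conflict with the node of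
round `r`. -/
noncomputable def ghostConflicting (q : Tree V) (r : ℕ) : Tree V :=
  fun k => if k < r ∧ Conflicting q r k then
    (q k).map (fun n => { n with status := Status.ghost }) else q k

def CanCommit (q : Tree V) (r : ℕ) : Prop := ∃ n, q r = some n ∧ n.status = Status.added

def setCommitted (q : Tree V) (r : ℕ) : Tree V :=
  Function.update q r ((q r).map (fun n => { n with status := Status.committed }))

/-- Method invocations `add(r, v, rₚ)` and `commit(r)`. -/
inductive Invocation (V : Type*)
  | add (r : ℕ) (v : V) (rp : ℕ)
  | commit (r : ℕ)

inductive Ret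
  | ok
  | fail

open Classical in
/-- Execution of an invocation: the next state and the value returned. -/
noncomputable def exec (q : Tree V) : Invocation V → Tree V × Ret
  | .add r v rp =>
      if CanAdd q r v rp then (ghostConflicting (insertNode q r v rp) r, Ret.ok)
      else (q, Ret.fail)
  | .commit r =>
      if CanCommit q r then (setCommitted q r, Ret.ok) else (q, Ret.fail)

/-- A composition of independent instances, one for each sequence number. The action
`(sn, i, ret)` is the invocation `i` on the instance `sn`, returning `ret`; all other instances
are left unchanged. -/
noncomputable def composition (V : Type*) : LTS (ℕ → Tree V) (ℕ × Invocation V × Ret) where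
  init := fun _ => initial V
  Tr := fun Q a Q' =>
    exec (Q a.1) a.2.1 = (Q' a.1, a.2.2) ∧ ∀ k, k ≠ a.1 → Q' k = Q k

/-- The four properties of a sequence of successful invocations on one instance. -/
structure GoodSequence (σ : List (Invocation V)) : Prop where
  /-- at most one `add(r, _, _)` for every `r` -/
  add_once : ∀ (i j r : ℕ) (v v' : V) (p p' : ℕ),
    σ[i]? = some (.add r v p) → σ[j]? = some (.add r v' p') → i = j
  /-- at most one `commit(r)` for every `r` -/
  commit_once : ∀ i j r : ℕ,
    σ[i]? = some (.commit r) → σ[j]? = some (.commit r) → i = j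
  /-- every `commit(r)` is preceded by an `add(r, _, _)` -/
  commit_after_add : ∀ i r : ℕ, σ[i]? = some (.commit r) →
    ∃ j < i, ∃ v p, σ[j]? = some (.add r v p)
  /-- if `rₚ > 0`, every `add(r, v, rₚ)` is preceded by an `add(rₚ, v', _)` with `v' = v`, and
  `rₚ < r` -/
  add_after_parent : ∀ (i r : ℕ) (v : V) (rp : ℕ), 0 < rp → σ[i]? = some (.add r v rp) →
    rp < r ∧ ∃ j < i, ∃ v' p, σ[j]? = some (.add rp v' p) ∧ v = v'
  /-- if `add(r, _, _)` and `add(r', _, r'')` occur and `r'' < r < r'`, then `commit(r)` does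
  not occur -/
  no_commit : ∀ (r r' r'' : ℕ) (v v' : V) (p : ℕ),
    Invocation.add r v p ∈ σ → Invocation.add r' v' r'' ∈ σ → r'' < r → r < r' →
    Invocation.commit r ∉ σ

end QTree

/-! ## The PBFT protocol -/

namespace PBFT

/-- The common content of the PROPOSE, JOIN and VOTE messages of a round for a sequence number:
round, sequence number, proposed value, and the round of the VOTE message that the leader
selected (`0` if there was none and the value is an arbitrary client value). -/
structure Content (V : Type*) where
  round : ℕ
  sn : ℕ
  value : V
  src : ℕ

/-- A signed JOIN message. -/
structure Join (P V : Type*) where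
  sender : P
  content : Content V

/-- A signed VOTE message, with a certificate consisting of signed JOIN messages. -/
structure Vote (P V : Type*) where
  sender : P
  content : Content V
  cert : Finset (Join P V)

/-- What a ROUND-CHANGE message says about one sequence number: nothing, because a quorum has
already agreed on it (`agreed`); that its sender has not voted for it (`noVote`); or the VOTE
message of highest round of its sender, with the certificate of that message. -/
inductive Report (P V : Type*)
  | agreed
  | noVote
  | voted (w : Vote P V)

/-- A signed ROUND-CHANGE message to the leader of the new round `round`. -/
structure RoundChange (P V : Type*) where
  sender : P
  round : ℕ
  report : ℕ → Report P V

/-- A signed PROPOSE message, with the ROUND-CHANGE messages that justify the selection. -/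
structure Propose (P V : Type*) where
  sender : P
  content : Content V
  cert : Finset (RoundChange P V)

inductive Msg (P V : Type*)
  | propose (m : Propose P V)
  | join (m : Join P V)
  | vote (m : Vote P V)
  | roundChange (m : RoundChange P V)

/-- The process that signs a message. -/
def Msg.sender {P V : Type*} : Msg P V → P
  | .propose m => m.sender
  | .join m => m.sender
  | .vote m => m.sender
  | .roundChange m => m.sender

/-- The signed messages that a message carries along as certificates. -/
def Msg.embedded {P V : Type*} : Msg P V → Set (Msg P V)
  | .propose m => {x | ∃ rc ∈ m.cert, x = .roundChange rc}
  | .join _ => ∅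
  | .vote m => {x | ∃ j ∈ m.cert, x = .join j}
  | .roundChange m => {x | ∃ sn w, m.report sn = .voted w ∧ x = .vote w}

/-- A global state: the current round and the decided values of every process, the messages
sent so far, and the messages that each process has received. -/
structure State (P V : Type*) where
  round : P → ℕ
  decidedVal : P → ℕ → Option V
  sent : Set (Msg P V)
  received : P → Set (Msg P V)

/-- The steps of a process: receiving a message, sending a message, deciding the value of `c`
for the sequence number of `c` in the round of `c`. -/
inductive Action (P V : Type*)
  | receive (p : P) (m : Msg P V)
  | send (p : P) (m : Msg P V)
  | decide (p : P) (c : Content V)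

/-- Initially every process is in round 1 and no message has been sent. -/
def initial (P V : Type*) : State P V where
  round := fun _ => 1
  decidedVal := fun _ _ => none
  sent := ∅
  received := fun _ => ∅

variable {P V : Type*}

/-- `R` contains JOIN messages with content `c` from a quorum (at least `2f+1` processes). -/
def JoinQuorum (f : ℕ) (R : Set (Msg P V)) (c : Content V) : Prop :=
  ∃ S : Finset P, 2 * f + 1 ≤ S.card ∧ ∀ p ∈ S, Msg.join ⟨p, c⟩ ∈ R

/-- `R` contains VOTE messages with content `c` from a quorum. -/
def VoteQuorum (f : ℕ) (R : Set (Msg P V)) (c : Content V) : Prop :=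
  ∃ S : Finset P, 2 * f + 1 ≤ S.card ∧
    ∀ p ∈ S, ∃ w : Vote P V, w.sender = p ∧ w.content = c ∧ Msg.vote w ∈ R

/-- The certificate of `w` holds JOIN messages with the content of `w` from a quorum. -/
def Certified (f : ℕ) (w : Vote P V) : Prop :=
  JoinQuorum f (Msg.embedded (.vote w)) w.content

/-- `rc` reports, for `sn`, the valid vote `w`: a certified VOTE message of the sender of `rc`
from an earlier round. -/
def ReportsVote (f : ℕ) (rc : RoundChange P V) (sn : ℕ) (w : Vote P V) : Prop :=
  rc.report sn = .voted w ∧ w.sender = rc.sender ∧ w.content.sn = sn ∧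
    w.content.round < rc.round ∧ Certified f w

/-- The content `c` of a PROPOSE message is selected correctly with respect to the ROUND-CHANGE
messages `cert`. In the initial round no selection takes place. In any later round, `cert`
consists of ROUND-CHANGE messages for this round that report on the sequence number, and comes
from a quorum; the value is that of the reported valid VOTE message of highest round, and it is
arbitrary if no valid VOTE message is reported. -/
def Justified (f : ℕ) (c : Content V) (cert : Finset (RoundChange P V)) : Prop :=
  (c.round = 1 ∧ c.src = 0) ∨
  (1 < c.round ∧
    (∀ rc ∈ cert, rc.round = c.round ∧ rc.report c.sn ≠ .agreed) ∧
    (∃ S : Finset P, 2 * f + 1 ≤ S.card ∧ ∀ p ∈ S, ∃ rc ∈ cert, rc.sender = p) ∧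
    ((c.src = 0 ∧ ∀ rc ∈ cert, ∀ w, ¬ ReportsVote f rc c.sn w) ∨
     (∃ rc ∈ cert, ∃ w, ReportsVote f rc c.sn w ∧
        w.content.round = c.src ∧ w.content.value = c.value ∧
        ∀ rc' ∈ cert, ∀ w', ReportsVote f rc' c.sn w' → w'.content.round ≤ c.src)))

/-- `p` has received a PROPOSE message with content `c` from the leader of the round of `c`. -/
def ReceivedPropose (leader : ℕ → P) (s : State P V) (p : P) (c : Content V) : Prop :=
  ∃ m : Propose P V, Msg.propose m ∈ s.received p ∧ m.sender = leader c.round ∧ m.content = c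

/-- A correct process `p` may report `ρ` for the sequence number `sn` in a ROUND-CHANGE message:
it leaves out a sequence number only if it has received a quorum of VOTE messages for it, and
otherwise sends the VOTE message of highest round that it has sent for it, if any. -/
def CorrectReport (f : ℕ) (s : State P V) (p : P) (sn : ℕ) : Report P V → Prop
  | .agreed => ∃ c : Content V, c.sn = sn ∧ VoteQuorum f (s.received p) c
  | .noVote => ∀ w : Vote P V, Msg.vote w ∈ s.sent → w.sender = p → w.content.sn ≠ sn
  | .voted w => Msg.vote w ∈ s.sent ∧ w.sender = p ∧ w.content.sn = sn ∧
      ∀ w' : Vote P V, Msg.vote w' ∈ s.sent → w'.sender = p → w'.content.sn = sn →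
        w'.content.round ≤ w.content.round

/-- When a correct process `p` may send a message. -/
def CorrectSend (f : ℕ) (leader : ℕ → P) (s : State P V) (p : P) : Msg P V → Prop
  -- the leader proposes, after receiving a quorum of ROUND-CHANGE messages
  | .propose m => leader m.content.round = p ∧ Justified f m.content m.cert ∧
      ∀ rc ∈ m.cert, Msg.roundChange rc ∈ s.received p
  -- `p` accepts the first correctly selected proposal in its current round
  | .join j => j.content.round = s.round p ∧
      (∀ j' : Join P V, Msg.join j' ∈ s.sent → j'.sender = p →
        ¬ (j'.content.round = j.content.round ∧ j'.content.sn = j.content.sn)) ∧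
      ∃ m : Propose P V, Msg.propose m ∈ s.received p ∧ m.sender = leader m.content.round ∧
        m.content = j.content ∧ Justified f m.content m.cert
  -- `p` votes, in its current round, after receiving a quorum of JOIN messages
  | .vote w => w.content.round = s.round p ∧ ReceivedPropose leader s p w.content ∧
      Certified f w ∧ ∀ j ∈ w.cert, Msg.join j ∈ s.received p
  -- on a timeout, `p` moves on to the next round
  | .roundChange rc => rc.round = s.round p + 1 ∧
      ∀ sn, CorrectReport f s p sn (rc.report sn)

open Classical in
/-- The effect of sending a message. A ROUND-CHANGE message also changes the sender's round. -/
noncomputable def afterSend (s : State P V) (p : P) (m : Msg P V) : State P V :=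
  { s with
    sent := insert m s.sent
    round := match m with
      | .roundChange rc => Function.update s.round p rc.round
      | _ => s.round }

open Classical in
/-- The transitions of PBFT. Messages may be delayed, reordered, duplicated or lost. Faulty
processes may send anything under their own signature, but cannot forge signatures: a message of
another process, or any certificate, can only be passed on after it has been received. They may
also claim to decide anything. -/
noncomputable def lts (f : ℕ) (faulty : Finset P) (leader : ℕ → P) :
    LTS (State P V) (Action P V) where
  init := initial P V
  Tr := fun s a s' =>
    match a with
    | .receive p m => m ∈ s.sent ∧
        s' = { s with received := Function.update s.received p (insert m (s.received p)) }
    | .send p m => m.sender = p ∧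
        (if p ∈ faulty then m.embedded ⊆ s.received p else CorrectSend f leader s p m) ∧
        s' = afterSend s p m
    | .decide p c =>
        (p ∈ faulty ∨ (c.round = s.round p ∧ ReceivedPropose leader s p c ∧
          JoinQuorum f (s.received p) c ∧ VoteQuorum f (s.received p) c)) ∧
        s' = { s with decidedVal := Function.update s.decidedVal p
                        (Function.update (s.decidedVal p) c.sn (some c.value)) }

/-- In this step (a state and the action taken in it) some process sends a VOTE message with
content `c` honestly, i.e., having received a quorum of JOIN messages with the same content. -/
def HonestVote (f : ℕ) (x : State P V × Action P V) (c : Content V) : Prop :=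
  ∃ p w, x.2 = .send p (.vote w) ∧ w.content = c ∧ JoinQuorum f (x.1.received p) c

/-- In this step some process decides `c` honestly, i.e., having received a quorum of JOIN
messages and a quorum of VOTE messages with the same content. -/
def HonestDecision (f : ℕ) (x : State P V × Action P V) (c : Content V) : Prop :=
  ∃ p, x.2 = .decide p c ∧ JoinQuorum f (x.1.received p) c ∧ VoteQuorum f (x.1.received p) c

open Classical in
/-- The successful invocation, if any, of which the step `x` is the linearization point, where
`past` are the steps before it: `sn.add(r, v, r')` at the first honest VOTE for `r` and `sn`, and
`sn.commit(r)` at the first honest decision for `r` and `sn`. -/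
noncomputable def linearizationPoint (f : ℕ) (past : List (State P V × Action P V))
    (x : State P V × Action P V) : Option (ℕ × QTree.Invocation V) :=
  match x.2 with
  | .send _ (.vote w) =>
      if HonestVote f x w.content ∧ ∀ y ∈ past, ∀ c, HonestVote f y c →
          ¬ (c.round = w.content.round ∧ c.sn = w.content.sn) then
        some (w.content.sn, .add w.content.round w.content.value w.content.src)
      else none
  | .decide _ d =>
      if HonestDecision f x d ∧ ∀ y ∈ past, ∀ c, HonestDecision f y c →
          ¬ (c.round = d.round ∧ c.sn = d.sn) then
        some (d.sn, .commit d.round)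
      else none
  | _ => none

/-- The invocations linearized along the steps of the second list, when the steps of the first
list have been taken before. -/
noncomputable def linearizeFrom (f : ℕ) :
    List (State P V × Action P V) → List (State P V × Action P V) →
      List (ℕ × QTree.Invocation V)
  | _, [] => []
  | past, x :: rest =>
      (linearizationPoint f past x).toList ++ linearizeFrom f (past ++ [x]) rest

/-- The sequence of successful invocations, each with the sequence number of its instance, in the
order of their linearization points along an execution. -/
noncomputable def linearize (f : ℕ) (E : List (State P V × Action P V)) :
    List (ℕ × QTree.Invocation V) :=
  linearizeFrom f [] E

/-- The corresponding actions of the composition of QTree instances; all of them return OK. -/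
noncomputable def gamma (f : ℕ) (E : List (State P V × Action P V)) :
    List (ℕ × QTree.Invocation V × QTree.Ret) :=
  (linearize f E).map fun x => (x.1, x.2, QTree.Ret.ok)

/-- The subsequence of the invocations on the instance `sn`. -/
def onInstance (sn : ℕ) (σ : List (ℕ × QTree.Invocation V)) : List (QTree.Invocation V) :=
  σ.filterMap fun x => if x.1 = sn then some x.2 else none

end PBFT

namespace QTree

variable {V : Type*}

/-! ### Good sequences and their prefixes -/

/-! The argument splits into a combinatorial half about trees and a protocol half, which meet at
`GoodSequence`.

Trees: by the `no_commit` property, a round `m` that is committed at any time, even later, is at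
most the parent round of every node above it (`GoodSequence.le_parent`). A descent along parent
links therefore cannot jump over `m`, and every node of round at least `m` extends `m`
(`Shape.extends_of_commit`). So a node that is still to be committed never conflicts with a node of
higher round and is never turned into a ghost, and a new node above the last committed one always
extends it. Hence every invocation of a good sequence succeeds (`GoodSequence.exec_run_eq_ok`), and
instances can be treated one by one (`mem_traces_composition`).

Protocol: two quorums share a correct process. Since it joins once per round and sequence number,
JOIN quorums agree (`Invariant.eq_of_joinQuorum`). If a quorum voted in round `r`, the certificate
of any later joined proposal contains the ROUND-CHANGE of a correct voter, so the selected source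
round is at least `r` (`Invariant.round_le_src`); this is `no_commit`. A selected vote is certified
by JOINs which its sender, correct or faulty, had received before, so it was honest and its node has
already been added (`Invariant.exists_source`). No induction over rounds is needed: the tree records
the chain of selections. -/

theorem mem_of_getElem?_prefix {α : Type*} {τ σ : List α} {a b : α} {j : ℕ}
    (h : τ ++ [a] <+: σ) (hj : σ[j]? = some b) (hlt : j < τ.length) : b ∈ τ := by
  obtain ⟨ρ, rfl⟩ := h
  rw [List.append_assoc, List.getElem?_append_left hlt] at hj
  exact List.mem_of_getElem? hj

theorem getElem?_length_of_prefix {α : Type*} {τ σ : List α} {a : α}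
    (h : τ ++ [a] <+: σ) : σ[τ.length]? = some a := by
  obtain ⟨ρ, rfl⟩ := h
  simp

theorem getElem?_of_mem_prefix {α : Type*} {τ σ : List α} {a b : α}
    (h : τ ++ [a] <+: σ) (hb : b ∈ τ) : ∃ j < τ.length, σ[j]? = some b := by
  obtain ⟨ρ, rfl⟩ := h
  obtain ⟨j, hj, rfl⟩ := List.getElem_of_mem hb
  refine ⟨j, hj, ?_⟩
  rw [List.append_assoc, List.getElem?_append_left hj]
  simp [hj]

namespace GoodSequence

variable {σ τ : List (Invocation V)}

theorem add_notMem_prefix (hσ : GoodSequence σ) {r p p' : ℕ} {v v' : V}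
    (h : τ ++ [.add r v p] <+: σ) : Invocation.add r v' p' ∉ τ := by
  intro hm
  obtain ⟨j, hj, hs⟩ := getElem?_of_mem_prefix h hm
  have := hσ.add_once _ _ _ _ _ _ _ hs (getElem?_length_of_prefix h)
  omega

theorem commit_notMem_prefix (hσ : GoodSequence σ) {r : ℕ}
    (h : τ ++ [.commit r] <+: σ) : Invocation.commit r ∉ τ := by
  intro hm
  obtain ⟨j, hj, hs⟩ := getElem?_of_mem_prefix h hm
  have := hσ.commit_once _ _ _ hs (getElem?_length_of_prefix h)
  omega

theorem add_mem_of_commit_prefix (hσ : GoodSequence σ) {r : ℕ}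
    (h : τ ++ [.commit r] <+: σ) : ∃ v p, Invocation.add r v p ∈ τ := by
  obtain ⟨j, hj, v, p, hs⟩ := hσ.commit_after_add _ _ (getElem?_length_of_prefix h)
  exact ⟨v, p, mem_of_getElem?_prefix h hs hj⟩

theorem parent_mem_of_add_prefix (hσ : GoodSequence σ) {r p : ℕ} {v : V}
    (h : τ ++ [.add r v p] <+: σ) (hp : 0 < p) :
    p < r ∧ ∃ p', Invocation.add p v p' ∈ τ := by
  obtain ⟨hlt, j, hj, v', p', hs, rfl⟩ :=
    hσ.add_after_parent _ _ _ _ hp (getElem?_length_of_prefix h)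
  exact ⟨hlt, p', mem_of_getElem?_prefix h hs hj⟩

/-- A committed round lies on or below the parent of every node of higher round. -/
theorem le_parent (hσ : GoodSequence σ) {m r p : ℕ} {v : V} (hm : Invocation.commit m ∈ σ)
    (hr : Invocation.add r v p ∈ σ) (hmr : m < r) : m ≤ p := by
  by_contra! hlt
  obtain ⟨i, hi, hs⟩ := List.getElem_of_mem hm
  obtain ⟨j, -, v', p', hj⟩ := hσ.commit_after_add i m (by simp [hi, hs])
  exact hσ.no_commit _ _ _ _ _ _ (List.mem_of_getElem? hj) hr hlt hmr hm

end GoodSequence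

/-! ### The tree built by a sequence of invocations -/

/-- The nodes of `q` other than the root are those added in `τ`. -/
structure Shape (τ : List (Invocation V)) (q : Tree V) : Prop where
  root : (q 0).isSome
  node : ∀ r n, q r = some n → r ≠ 0 → ∃ v, n.value = some v ∧ Invocation.add r v n.parent ∈ τ
  mem : ∀ r v p, Invocation.add r v p ∈ τ → ∃ n, q r = some n ∧ n.value = some v

/-- The statuses of the nodes of `q`, reached after the part `τ` of the sequence `σ`. -/
structure Statuses (σ τ : List (Invocation V)) (q : Tree V) : Prop where
  root : ∃ n, q 0 = some n ∧ n.status = Status.committed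
  committed : ∀ r n, q r = some n → n.status = Status.committed →
    r = 0 ∨ Invocation.commit r ∈ τ
  of_mem : ∀ r, Invocation.commit r ∈ τ → ∃ n, q r = some n ∧ n.status = Status.committed
  added : ∀ r n, Invocation.commit r ∈ σ → Invocation.commit r ∉ τ → q r = some n →
    n.status = Status.added

/-- The parent of every node added in `τ` is the root or was added in `τ` as well. -/
def ParentClosed (τ : List (Invocation V)) : Prop :=
  ∀ r v p, Invocation.add r v p ∈ τ →
    0 < r ∧ p < r ∧ (0 < p → ∃ v' p', Invocation.add p v' p' ∈ τ)

theorem parentClosed_of_prefix {σ : List (Invocation V)} (hσ : GoodSequence σ)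
    (hpos : ∀ r v p, Invocation.add r v p ∈ σ → 0 < r) (τ : List (Invocation V)) :
    τ <+: σ → ParentClosed τ := by
  induction τ using List.reverseRecOn with
  | nil => intro _ r v p h; simp at h
  | append_singleton τ i ih =>
    intro hpre r v p h
    have hr := hpos r v p (hpre.subset h)
    rcases List.mem_append.1 h with h | h
    · obtain ⟨_, h1, h2⟩ := ih ((List.prefix_append _ _).trans hpre) r v p h
      refine ⟨hr, h1, fun hp => ?_⟩
      obtain ⟨v', p', h'⟩ := h2 hp
      exact ⟨v', p', List.mem_append_left _ h'⟩
    · rw [List.mem_singleton] at h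
      subst h
      rcases Nat.eq_zero_or_pos p with rfl | hp
      · exact ⟨hr, hr, fun h => absurd h (lt_irrefl _)⟩
      · obtain ⟨h1, p', h2⟩ := hσ.parent_mem_of_add_prefix hpre hp
        exact ⟨hr, h1, fun _ => ⟨v, p', List.mem_append_left _ h2⟩⟩

/-- Every node extends each node of smaller round that is the root or committed at some time. -/
theorem Shape.extends_of_commit {σ τ : List (Invocation V)} {q : Tree V} (hσ : GoodSequence σ)
    (hτ : τ ⊆ σ) (hcl : ParentClosed τ) (hq : Shape τ q) {m : ℕ}
    (hm : m = 0 ∨ Invocation.commit m ∈ σ) (r : ℕ) :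
    (q r).isSome → m ≤ r → Extends q r m ∧ (q m).isSome := by
  induction r using Nat.strong_induction_on with
  | _ r ih =>
    intro hr hmr
    rcases hmr.eq_or_lt with rfl | hlt
    · exact ⟨Relation.ReflTransGen.refl, hr⟩
    obtain ⟨n, hn⟩ := Option.isSome_iff_exists.1 hr
    obtain ⟨v, -, hadd⟩ := hq.node r n hn (by omega)
    obtain ⟨-, hpr, hp⟩ := hcl _ _ _ hadd
    -- The descent to the parent stays at or above `m`, so it can only end in `m` itself.
    have hmp : m ≤ n.parent := by
      rcases hm with rfl | hm
      · exact Nat.zero_le _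
      · exact hσ.le_parent hm (hτ hadd) hlt
    have hps : (q n.parent).isSome := by
      rcases Nat.eq_zero_or_pos n.parent with h0 | h0
      · rw [h0]; exact hq.root
      · obtain ⟨v', p', h'⟩ := hp h0
        obtain ⟨n', hn', -⟩ := hq.mem _ _ _ h'
        simp [hn']
    obtain ⟨h1, h2⟩ := ih _ hpr hps hmp
    exact ⟨Relation.ReflTransGen.head ⟨n, hn, rfl⟩ h1, h2⟩

/-- Committed rounds are finite in number, being the root or one of the commits of the list `τ`, and
the root is always among them. -/
theorem Statuses.exists_maxCommitted {σ τ : List (Invocation V)} {q : Tree V}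
    (hs : Statuses σ τ q) : ∃ m, MaxCommitted q m := by
  have hfin : {m | ∃ n, q m = some n ∧ n.status = Status.committed}.Finite := by
    have h1 : (Invocation.commit ⁻¹' {x : Invocation V | x ∈ τ}).Finite :=
      (List.finite_toSet τ).preimage fun a _ b _ h => by injection h
    refine ((Set.finite_singleton 0).union h1).subset ?_
    rintro m ⟨n, hn, hc⟩
    exact hs.committed m n hn hc
  obtain ⟨m, hm, hmax⟩ := Set.exists_max_image _ id hfin ⟨0, hs.root⟩
  exact ⟨m, hm, fun k n hk hc => hmax k ⟨n, hk, hc⟩⟩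

/-- The delicate condition is `ExtendsTrunk`. If the last committed round `m` lies below `r`, then
`le_parent`, applied in `σ` to the node about to be added, puts `m` at or below its parent, and the
parent then extends `m`. -/
theorem canAdd_of_prefix {σ τ : List (Invocation V)} {q : Tree V} (hσ : GoodSequence σ)
    (hpos : ∀ r v p, Invocation.add r v p ∈ σ → 0 < r) (hq : Shape τ q) (hs : Statuses σ τ q)
    {r p : ℕ} {v : V} (hpre : τ ++ [.add r v p] <+: σ) : CanAdd q r v p := by
  have hτσ : τ <+: σ := (List.prefix_append _ _).trans hpre
  have hcl := parentClosed_of_prefix hσ hpos τ hτσ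
  have hmemσ : Invocation.add r v p ∈ σ := hpre.subset (by simp)
  obtain ⟨hr, hpr, -⟩ := parentClosed_of_prefix hσ hpos _ hpre r v p (by simp)
  have hvalue : p ≠ 0 → ∃ n, q p = some n ∧ n.value = some v := fun hp => by
    obtain ⟨-, p', h⟩ := hσ.parent_mem_of_add_prefix hpre (Nat.pos_of_ne_zero hp)
    exact hq.mem _ _ _ h
  have hparent : (q p).isSome := by
    rcases eq_or_ne p 0 with rfl | hp
    · exact hq.root
    · obtain ⟨n, hn, -⟩ := hvalue hp
      simp [hn]
  have hnew : q r = none := by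
    by_contra hne
    obtain ⟨n, hn⟩ := Option.ne_none_iff_exists'.1 hne
    obtain ⟨v', -, h⟩ := hq.node r n hn (by omega)
    exact hσ.add_notMem_prefix hpre h
  refine ⟨hr, ⟨hparent, hpr⟩, hnew, ?_, hvalue⟩
  obtain ⟨m, hm⟩ := hs.exists_maxCommitted
  refine ⟨m, hm, ?_⟩
  obtain ⟨⟨n, hn, hc⟩, -⟩ := hm
  have hm' : m = 0 ∨ Invocation.commit m ∈ σ :=
    (hs.committed m n hn hc).imp_right fun h => hτσ.subset h
  rcases lt_trichotomy r m with h | rfl | h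
  · exact Or.inr h
  -- The case `r = m` is impossible, since `m` is in the tree and `r` is not.
  · simp [hnew] at hn
  · refine Or.inl (hq.extends_of_commit hσ hτσ.subset hcl hm' p hparent ?_).1
    rcases hm' with rfl | hm'
    · exact Nat.zero_le _
    · exact hσ.le_parent hm' hmemσ h

theorem shape_insertNode {τ : List (Invocation V)} {q : Tree V} (hq : Shape τ q) {r p : ℕ} {v : V}
    (hr : 0 < r) (hnew : q r = none) : Shape (τ ++ [.add r v p]) (insertNode q r v p) where
  root := by simpa [insertNode, Function.update_of_ne hr.ne] using hq.root
  node k n hk h0 := by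
    rcases eq_or_ne k r with rfl | hne
    · simp only [insertNode, Function.update_self, Option.some.injEq] at hk
      subst hk
      exact ⟨v, rfl, by simp⟩
    · rw [insertNode, Function.update_of_ne hne] at hk
      obtain ⟨v', h1, h2⟩ := hq.node k n hk h0
      exact ⟨v', h1, List.mem_append_left _ h2⟩
  mem k v' p' h := by
    rcases List.mem_append.1 h with h | h
    · obtain ⟨n, hn, hv⟩ := hq.mem _ _ _ h
      have hne : k ≠ r := by rintro rfl; simp [hnew] at hn
      exact ⟨n, by rw [insertNode, Function.update_of_ne hne, hn], hv⟩
    · simp only [List.mem_singleton, Invocation.add.injEq] at h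
      obtain ⟨rfl, rfl, rfl⟩ := h
      exact ⟨_, by rw [insertNode, Function.update_self], rfl⟩

/-- Two trees that differ only in the statuses of their nodes. -/
def SameNodes (q q' : Tree V) : Prop :=
  ∀ k, (q k).map (fun n => (n.value, n.parent)) = (q' k).map (fun n => (n.value, n.parent))

theorem Shape.congr {τ : List (Invocation V)} {q q' : Tree V} (hq : Shape τ q)
    (h : SameNodes q q') : Shape τ q' where
  root := by
    have h0 := congrArg Option.isSome (h 0)
    simpa [hq.root] using h0.symm
  node k n hk h0 := by
    have h1 := h k
    rw [hk, Option.map_some, Option.map_eq_some_iff] at h1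
    obtain ⟨n', hn', h2⟩ := h1
    obtain ⟨h2, h3⟩ := Prod.mk.inj h2
    obtain ⟨v, h4, h5⟩ := hq.node k n' hn' h0
    exact ⟨v, h2 ▸ h4, h3 ▸ h5⟩
  mem k v p hm := by
    obtain ⟨n, hn, hv⟩ := hq.mem k v p hm
    have h1 := (h k).symm
    rw [hn, Option.map_some, Option.map_eq_some_iff] at h1
    obtain ⟨n', hn', h2⟩ := h1
    exact ⟨n', hn', (Prod.mk.inj h2).1.trans hv⟩

theorem sameNodes_ghostConflicting (q : Tree V) (r : ℕ) :
    SameNodes q (ghostConflicting q r) := by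
  intro k
  unfold ghostConflicting
  split_ifs
  · simp [Option.map_map, Function.comp_def]
  · rfl

theorem sameNodes_setCommitted (q : Tree V) (r : ℕ) : SameNodes q (setCommitted q r) := by
  intro k
  rcases eq_or_ne k r with rfl | hne
  · simp [setCommitted, Option.map_map, Function.comp_def]
  · rw [setCommitted, Function.update_of_ne hne]

/-- Statuses are measured against all of `σ` because ghosting threatens future commits. Both ways of
becoming a ghost are excluded for a round committed anywhere in `σ`: the new node extends every such
round below it, and if the new round is itself such, no higher node can exist yet. -/
theorem statuses_add {σ τ : List (Invocation V)} {q : Tree V} (hσ : GoodSequence σ)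
    (hpos : ∀ r v p, Invocation.add r v p ∈ σ → 0 < r) (hq : Shape τ q) (hs : Statuses σ τ q)
    {r p : ℕ} {v : V} (hpre : τ ++ [.add r v p] <+: σ) (hcan : CanAdd q r v p) :
    Statuses σ (τ ++ [.add r v p]) (ghostConflicting (insertNode q r v p) r) := by
  have hτσ : τ <+: σ := (List.prefix_append _ _).trans hpre
  have hcl := parentClosed_of_prefix hσ hpos τ hτσ
  have hcl' := parentClosed_of_prefix hσ hpos _ hpre
  have hr := hcan.1
  have hnew : q r = none := hcan.2.2.1
  have hshape : Shape (τ ++ [.add r v p]) (insertNode q r v p) := shape_insertNode hq hr hnew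
  have hrs : (insertNode q r v p r).isSome := by simp [insertNode]
  have hcm : ∀ k, Invocation.commit k ∈ τ ++ [.add r v p] ↔ Invocation.commit k ∈ τ := by simp
  -- nodes that are the root or committed at some time keep their status
  have hkeep : ∀ k, k = 0 ∨ Invocation.commit k ∈ σ → k ≠ r →
      ghostConflicting (insertNode q r v p) r k = q k := by
    intro k hk hne
    have hns : ¬ (k < r ∧ Conflicting (insertNode q r v p) r k) := by
      rintro ⟨hlt, hc, -⟩
      exact hc (hshape.extends_of_commit hσ hpre.subset hcl' hk r hrs hlt.le).1
    rw [ghostConflicting, if_neg hns, insertNode, Function.update_of_ne hne]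
  have hself : ghostConflicting (insertNode q r v p) r r = insertNode q r v p r := by
    simp [ghostConflicting]
  refine ⟨?_, ?_, ?_, ?_⟩
  · rw [hkeep 0 (Or.inl rfl) hr.ne]
    exact hs.root
  · intro k n hk hc
    rcases eq_or_ne k r with rfl | hne
    · rw [hself, insertNode, Function.update_self, Option.some.injEq] at hk
      subst hk
      dsimp only at hc
      -- The inserted node is a ghost or added, never committed.
      split_ifs at hc
    · rw [hcm]
      unfold ghostConflicting at hk
      split_ifs at hk
      · obtain ⟨n', -, rfl⟩ := Option.map_eq_some_iff.1 hk
        cases hc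
      · rw [insertNode, Function.update_of_ne hne] at hk
        exact hs.committed k n hk hc
  · intro k hk
    rw [hcm] at hk
    obtain ⟨n, hn, hc⟩ := hs.of_mem k hk
    have hne : k ≠ r := by rintro rfl; simp [hnew] at hn
    exact ⟨n, by rw [hkeep k (Or.inr (hτσ.subset hk)) hne, hn], hc⟩
  · intro k n hkσ hkτ hk
    rw [hcm] at hkτ
    rcases eq_or_ne k r with rfl | hne
    -- A node above `k` would extend `k`, so `k` would already be in the tree.
    · have hno : ¬ ∃ j, k < j ∧ (q j).isSome := by
        rintro ⟨j, hj, hjs⟩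
        have := (hq.extends_of_commit hσ hτσ.subset hcl (Or.inr hkσ) j hjs hj.le).2
        simp [hnew] at this
      rw [hself, insertNode, Function.update_self, if_neg hno, Option.some.injEq] at hk
      subst hk
      rfl
    · rw [hkeep k (Or.inr hkσ) hne] at hk
      exact hs.added k n hkσ hkτ hk

/-- The commit of `r` is in `σ` but not yet in `τ`, exactly the situation in which `Statuses.added`
guarantees the status. -/
theorem canCommit_of_prefix {σ τ : List (Invocation V)} {q : Tree V} (hσ : GoodSequence σ)
    (hq : Shape τ q) (hs : Statuses σ τ q) {r : ℕ} (hpre : τ ++ [.commit r] <+: σ) :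
    CanCommit q r := by
  obtain ⟨v, p, h⟩ := hσ.add_mem_of_commit_prefix hpre
  obtain ⟨n, hn, -⟩ := hq.mem _ _ _ h
  exact ⟨n, hn, hs.added r n (hpre.subset (by simp)) (hσ.commit_notMem_prefix hpre) hn⟩

theorem statuses_commit {σ τ : List (Invocation V)} {q : Tree V} (hs : Statuses σ τ q) {r : ℕ}
    (hcan : CanCommit q r) : Statuses σ (τ ++ [.commit r]) (setCommitted q r) := by
  obtain ⟨n₀, hn₀, -⟩ := hcan
  have hself : setCommitted q r r = some { n₀ with status := Status.committed } := by
    simp [setCommitted, hn₀]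
  have hother : ∀ k, k ≠ r → setCommitted q r k = q k := fun k hk => by
    rw [setCommitted, Function.update_of_ne hk]
  refine ⟨?_, ?_, ?_, ?_⟩
  · rcases eq_or_ne 0 r with rfl | hne
    · exact ⟨_, hself, rfl⟩
    · rw [hother 0 hne]; exact hs.root
  · intro k n hk hc
    rcases eq_or_ne k r with rfl | hne
    · exact Or.inr (by simp)
    · rw [hother k hne] at hk
      exact (hs.committed k n hk hc).imp_right (List.mem_append_left _)
  · intro k hk
    rcases eq_or_ne k r with rfl | hne
    · exact ⟨_, hself, rfl⟩
    · rw [hother k hne]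
      exact hs.of_mem k (by simpa [hne] using hk)
  · intro k n hkσ hkτ hk
    simp only [List.mem_append, List.mem_singleton, Invocation.commit.injEq, not_or] at hkτ
    rw [hother k hkτ.2] at hk
    exact hs.added k n hkσ hkτ.1 hk

/-! ### Running a good sequence, and traces of the composition -/

/-- The tree reached from the initial one by a sequence of invocations. -/
noncomputable def run (τ : List (Invocation V)) : Tree V :=
  τ.foldl (fun q i => (exec q i).1) (initial V)

theorem run_append_singleton (τ : List (Invocation V)) (i : Invocation V) :
    run (τ ++ [i]) = (exec (run τ) i).1 := by
  simp [run]

/-- The invariants and the success of invocations are proved together: the invariants before an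
invocation make it succeed, and its success determines the next tree. -/
theorem shape_and_statuses_run {σ : List (Invocation V)} (hσ : GoodSequence σ)
    (hpos : ∀ r v p, Invocation.add r v p ∈ σ → 0 < r) (τ : List (Invocation V)) :
    τ <+: σ → Shape τ (run τ) ∧ Statuses σ τ (run τ) := by
  induction τ using List.reverseRecOn with
  | nil =>
    intro _
    refine ⟨⟨by simp [run, initial], ?_, by simp⟩, ⟨⟨_, rfl, rfl⟩, ?_, by simp, ?_⟩⟩
    · intro r n hn hr
      simp [run, initial, hr] at hn
    · intro r n hn _
      by_contra h
      simp only [List.not_mem_nil, or_false] at h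
      simp [run, initial, h] at hn
    · intro r n hr _ hn
      obtain ⟨i, hi, hs⟩ := List.getElem_of_mem hr
      obtain ⟨j, -, v, p, hj⟩ := hσ.commit_after_add i r (by simp [hi, hs])
      -- A committed round has been added, hence is positive; the initial tree has no such node.
      have h0 := hpos _ _ _ (List.mem_of_getElem? hj)
      simp [run, initial, h0.ne'] at hn
  | append_singleton τ i ih =>
    intro hpre
    obtain ⟨hq, hs⟩ := ih ((List.prefix_append _ _).trans hpre)
    rw [run_append_singleton]
    cases i with
    | add r v p =>
      have hcan := canAdd_of_prefix hσ hpos hq hs hpre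
      rw [exec, if_pos hcan]
      exact ⟨(shape_insertNode hq hcan.1 hcan.2.2.1).congr (sameNodes_ghostConflicting _ _),
        statuses_add hσ hpos hq hs hpre hcan⟩
    | commit r =>
      have hcan := canCommit_of_prefix hσ hq hs hpre
      rw [exec, if_pos hcan]
      refine ⟨?_, statuses_commit hs hcan⟩
      have hq' := hq.congr (sameNodes_setCommitted _ r)
      exact ⟨hq'.root, fun k n hk h0 => by simpa using hq'.node k n hk h0,
        fun k v p h => hq'.mem k v p (by simpa using h)⟩

/-- Every invocation of a good sequence succeeds. -/
theorem GoodSequence.exec_run_eq_ok {σ τ : List (Invocation V)} (hσ : GoodSequence σ)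
    (hpos : ∀ r v p, Invocation.add r v p ∈ σ → 0 < r) {i : Invocation V}
    (hpre : τ ++ [i] <+: σ) : (exec (run τ) i).2 = Ret.ok := by
  obtain ⟨hq, hs⟩ := shape_and_statuses_run hσ hpos τ ((List.prefix_append _ _).trans hpre)
  cases i with
  | add r v p => rw [exec, if_pos (canAdd_of_prefix hσ hpos hq hs hpre)]
  | commit r => rw [exec, if_pos (canCommit_of_prefix hσ hq hs hpre)]

theorem onInstance_append (sn : ℕ) (σ τ : List (ℕ × Invocation V)) :
    PBFT.onInstance sn (σ ++ τ) = PBFT.onInstance sn σ ++ PBFT.onInstance sn τ := by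
  simp [PBFT.onInstance]

/-- A sequence of invocations that is good on every instance is a trace of the composition. -/
theorem mem_traces_composition {L : List (ℕ × Invocation V)}
    (hgood : ∀ sn, GoodSequence (PBFT.onInstance sn L))
    (hpos : ∀ sn r v p, Invocation.add r v p ∈ PBFT.onInstance sn L → 0 < r) :
    L.map (fun x => (x.1, x.2, Ret.ok)) ∈ (composition V).traces := by
  -- The induction is over prefixes of a fixed `L`, since the status invariant refers to commits
  -- still to come.
  suffices h : ∀ K, K <+: L → ∃ E, (composition V).Execution E
      (fun sn => run (PBFT.onInstance sn K)) ∧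
      E.map Prod.snd = K.map (fun x => (x.1, x.2, Ret.ok)) by
    obtain ⟨E, hE, h⟩ := h L (List.prefix_refl L)
    exact ⟨E, _, hE, h⟩
  intro K
  induction K using List.reverseRecOn with
  | nil => exact fun _ => ⟨[], LTS.Execution.nil, rfl⟩
  | append_singleton K x ih =>
    intro hpre
    obtain ⟨sn, i⟩ := x
    obtain ⟨E, hE, h⟩ := ih ((List.prefix_append _ _).trans hpre)
    have hsn : PBFT.onInstance sn (K ++ [(sn, i)]) = PBFT.onInstance sn K ++ [i] := by
      simp [PBFT.onInstance]
    have hpre' : PBFT.onInstance sn K ++ [i] <+: PBFT.onInstance sn L := by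
      obtain ⟨M, rfl⟩ := hpre
      exact ⟨PBFT.onInstance sn M, by rw [← hsn, ← onInstance_append]⟩
    refine ⟨_, hE.snoc (a := (sn, i, Ret.ok)) ⟨?_, fun k hk => ?_⟩, by simp [h]⟩
    · dsimp only
      rw [hsn, run_append_singleton, ← (hgood sn).exec_run_eq_ok (hpos sn) hpre']
    · simp [PBFT.onInstance, hk.symm]

/-! ### Extending a good sequence -/

theorem getElem?_concat_eq_some {α : Type*} {σ : List α} {a b : α} {i : ℕ}
    (h : (σ ++ [a])[i]? = some b) : σ[i]? = some b ∨ (i = σ.length ∧ b = a) := by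
  rcases lt_trichotomy i σ.length with hi | rfl | hi
  · rw [List.getElem?_append_left hi] at h
    exact Or.inl h
  · simp at h
    exact Or.inr ⟨rfl, h.symm⟩
  · rw [List.getElem?_eq_none (by simp; omega)] at h
    cases h

theorem getElem?_concat_of_eq_some {α : Type*} {σ : List α} {b : α} {i : ℕ} (a : α)
    (h : σ[i]? = some b) : (σ ++ [a])[i]? = some b := by
  obtain ⟨hi, -⟩ := List.getElem?_eq_some_iff.1 h
  rwa [List.getElem?_append_left hi]

namespace GoodSequence

variable {σ : List (Invocation V)}

theorem nil : GoodSequence ([] : List (Invocation V)) := by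
  constructor <;> simp

/-- The condition on skipped commits is assumed for the extended sequence as a whole: a new node can
violate it against older commits, and the protocol yields it directly at every state. -/
theorem concat_add (hσ : GoodSequence σ) {r p : ℕ} {v : V}
    (hnew : ∀ v' p', Invocation.add r v' p' ∉ σ)
    (hparent : 0 < p → p < r ∧ ∃ p', Invocation.add p v p' ∈ σ)
    (hno : ∀ (k k' k'' : ℕ) (w w' : V) (p' : ℕ), Invocation.add k w p' ∈ σ ++ [.add r v p] →
      Invocation.add k' w' k'' ∈ σ ++ [.add r v p] → k'' < k → k < k' →
      Invocation.commit k ∉ σ ++ [.add r v p]) :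
    GoodSequence (σ ++ [.add r v p]) where
  add_once i j k w w' p' p'' hi hj := by
    rcases getElem?_concat_eq_some hi with hi | ⟨rfl, hi'⟩ <;>
      rcases getElem?_concat_eq_some hj with hj | ⟨rfl, hj'⟩
    · exact hσ.add_once _ _ _ _ _ _ _ hi hj
    · cases hj'
      exact absurd (List.mem_of_getElem? hi) (hnew _ _)
    · cases hi'
      exact absurd (List.mem_of_getElem? hj) (hnew _ _)
    · rfl
  commit_once i j k hi hj := by
    rcases getElem?_concat_eq_some hi with hi | ⟨-, hi'⟩
    · rcases getElem?_concat_eq_some hj with hj | ⟨-, hj'⟩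
      · exact hσ.commit_once _ _ _ hi hj
      · cases hj'
    · cases hi'
  commit_after_add i k hi := by
    rcases getElem?_concat_eq_some hi with hi | ⟨-, hi'⟩
    · obtain ⟨j, hj, w, p', h⟩ := hσ.commit_after_add i k hi
      exact ⟨j, hj, w, p', getElem?_concat_of_eq_some _ h⟩
    · cases hi'
  add_after_parent i k w p' hp hi := by
    rcases getElem?_concat_eq_some hi with hi | ⟨rfl, hi'⟩
    · obtain ⟨hlt, j, hj, w', p'', h, hw⟩ := hσ.add_after_parent i k w p' hp hi
      exact ⟨hlt, j, hj, w', p'', getElem?_concat_of_eq_some _ h, hw⟩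
    · cases hi'
      obtain ⟨hlt, p', h⟩ := hparent hp
      obtain ⟨j, hj, h⟩ := getElem?_of_mem_prefix (List.prefix_refl (σ ++ [.add r v p])) h
      exact ⟨hlt, j, hj, _, p', h, rfl⟩
  no_commit := hno

theorem concat_commit (hσ : GoodSequence σ) {r : ℕ} (hnew : Invocation.commit r ∉ σ)
    (hadd : ∃ v p, Invocation.add r v p ∈ σ)
    (hno : ∀ (k k' k'' : ℕ) (w w' : V) (p' : ℕ), Invocation.add k w p' ∈ σ ++ [.commit r] →
      Invocation.add k' w' k'' ∈ σ ++ [.commit r] → k'' < k → k < k' →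
      Invocation.commit k ∉ σ ++ [.commit r]) :
    GoodSequence (σ ++ [.commit r]) where
  add_once i j k w w' p' p'' hi hj := by
    rcases getElem?_concat_eq_some hi with hi | ⟨-, hi'⟩
    · rcases getElem?_concat_eq_some hj with hj | ⟨-, hj'⟩
      · exact hσ.add_once _ _ _ _ _ _ _ hi hj
      · cases hj'
    · cases hi'
  commit_once i j k hi hj := by
    rcases getElem?_concat_eq_some hi with hi | ⟨rfl, hi'⟩ <;>
      rcases getElem?_concat_eq_some hj with hj | ⟨rfl, hj'⟩
    · exact hσ.commit_once _ _ _ hi hj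
    · cases hj'
      exact absurd (List.mem_of_getElem? hi) hnew
    · cases hi'
      exact absurd (List.mem_of_getElem? hj) hnew
    · rfl
  commit_after_add i k hi := by
    rcases getElem?_concat_eq_some hi with hi | ⟨rfl, hi'⟩
    · obtain ⟨j, hj, w, p', h⟩ := hσ.commit_after_add i k hi
      exact ⟨j, hj, w, p', getElem?_concat_of_eq_some _ h⟩
    · cases hi'
      obtain ⟨w, p', h⟩ := hadd
      obtain ⟨j, hj, h⟩ := getElem?_of_mem_prefix (List.prefix_refl (σ ++ [.commit r])) h
      exact ⟨j, hj, w, p', h⟩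
  add_after_parent i k w p' hp hi := by
    rcases getElem?_concat_eq_some hi with hi | ⟨-, hi'⟩
    · obtain ⟨hlt, j, hj, w', p'', h, hw⟩ := hσ.add_after_parent i k w p' hp hi
      exact ⟨hlt, j, hj, w', p'', getElem?_concat_of_eq_some _ h, hw⟩
    · cases hi'
  no_commit := hno

end GoodSequence

end QTree

namespace PBFT

variable {P V : Type*}

/-! ### Quorums -/

theorem exists_correct_of_quorum {f : ℕ} {faulty S : Finset P} (hfaulty : faulty.card ≤ f)
    (hS : 2 * f + 1 ≤ S.card) : ∃ p ∈ S, p ∉ faulty := by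
  by_contra! h
  have := Finset.card_le_card (show S ⊆ faulty from h)
  omega

/-- Two quorums among `3f+1` processes overlap in at least `2(2f+1) - (3f+1) = f+1` of them, more
than the faulty ones. -/
theorem exists_correct_of_two_quorums [Fintype P] {f : ℕ} (hP : Fintype.card P = 3 * f + 1)
    {faulty S T : Finset P} (hfaulty : faulty.card ≤ f) (hS : 2 * f + 1 ≤ S.card)
    (hT : 2 * f + 1 ≤ T.card) : ∃ p ∈ S, p ∈ T ∧ p ∉ faulty := by
  classical
  by_contra! h
  have h1 : (S ∩ T).card ≤ faulty.card :=
    Finset.card_le_card fun p hp => h p (Finset.mem_inter.1 hp).1 (Finset.mem_inter.1 hp).2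
  have h2 := Finset.card_union_add_card_inter S T
  have h3 := Finset.card_le_univ (S ∪ T)
  omega

theorem JoinQuorum.mono {f : ℕ} {R R' : Set (Msg P V)} {c : Content V} (h : JoinQuorum f R c)
    (hR : R ⊆ R') : JoinQuorum f R' c := by
  obtain ⟨S, hS, h⟩ := h
  exact ⟨S, hS, fun p hp => hR (h p hp)⟩

theorem VoteQuorum.mono {f : ℕ} {R R' : Set (Msg P V)} {c : Content V} (h : VoteQuorum f R c)
    (hR : R ⊆ R') : VoteQuorum f R' c := by
  obtain ⟨S, hS, h⟩ := h
  refine ⟨S, hS, fun p hp => ?_⟩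
  obtain ⟨w, h1, h2, h3⟩ := h p hp
  exact ⟨w, h1, h2, hR h3⟩

/-! ### The invariant of the protocol -/

/-- What holds in the state `s` that is reached by the steps `E`. -/
structure Invariant (f : ℕ) (faulty : Finset P) (E : List (State P V × Action P V))
    (s : State P V) : Prop where
  received_subset : ∀ p, s.received p ⊆ s.sent
  embedded_subset : ∀ m ∈ s.sent, m.embedded ⊆ s.sent
  join_justified : ∀ j : Join P V, Msg.join j ∈ s.sent → j.sender ∉ faulty →
    ∃ cert, Justified f j.content cert ∧ ∀ rc ∈ cert, Msg.roundChange rc ∈ s.sent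
  join_unique : ∀ j j' : Join P V, Msg.join j ∈ s.sent → Msg.join j' ∈ s.sent →
    j.sender ∉ faulty → j'.sender = j.sender → j.content.round = j'.content.round →
    j.content.sn = j'.content.sn → j.content = j'.content
  vote_correct : ∀ w : Vote P V, Msg.vote w ∈ s.sent → w.sender ∉ faulty →
    w.content.round ≤ s.round w.sender ∧ Certified f w
  roundChange_le : ∀ rc : RoundChange P V, Msg.roundChange rc ∈ s.sent → rc.sender ∉ faulty →
    rc.round ≤ s.round rc.sender
  report_noVote : ∀ (rc : RoundChange P V) (sn : ℕ), Msg.roundChange rc ∈ s.sent →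
    rc.sender ∉ faulty → rc.report sn = .noVote → ∀ w : Vote P V, Msg.vote w ∈ s.sent →
    w.sender = rc.sender → w.content.sn = sn → rc.round ≤ w.content.round
  report_voted : ∀ (rc : RoundChange P V) (sn : ℕ) (w : Vote P V), Msg.roundChange rc ∈ s.sent →
    rc.sender ∉ faulty → rc.report sn = .voted w →
    ReportsVote f rc sn w ∧ ∀ w' : Vote P V, Msg.vote w' ∈ s.sent → w'.sender = rc.sender →
      w'.content.sn = sn → w'.content.round ≤ w.content.round ∨ rc.round ≤ w'.content.round
  vote_honest : ∀ w : Vote P V, Msg.vote w ∈ s.sent → Certified f w →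
    ∃ x ∈ E, HonestVote f x w.content
  joins_of_honestVote : ∀ x ∈ E, ∀ c, HonestVote f x c → JoinQuorum f s.sent c
  quorums_of_honestDecision : ∀ x ∈ E, ∀ c, HonestDecision f x c →
    JoinQuorum f s.sent c ∧ VoteQuorum f s.sent c

variable {f : ℕ} {faulty : Finset P} {E : List (State P V × Action P V)} {s : State P V}

theorem Invariant.init : Invariant f faulty [] (initial P V) := by
  constructor <;> simp [initial]

/-- Honest votes and decisions of the next step are backed by messages sent before. -/
theorem Invariant.concat (h : Invariant f faulty E s) (a : Action P V) {s' : State P V}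
    (hsent : s.sent ⊆ s'.sent) :
    (∀ x ∈ E ++ [(s, a)], ∀ c, HonestVote f x c → JoinQuorum f s'.sent c) ∧
    ∀ x ∈ E ++ [(s, a)], ∀ c, HonestDecision f x c →
      JoinQuorum f s'.sent c ∧ VoteQuorum f s'.sent c := by
  constructor <;> intro x hx c hc <;> rcases List.mem_append.1 hx with hx | hx
  · exact (h.joins_of_honestVote x hx c hc).mono hsent
  · obtain rfl := List.mem_singleton.1 hx
    obtain ⟨p, w, -, -, hq⟩ := hc
    exact hq.mono ((h.received_subset p).trans hsent)
  · exact (h.quorums_of_honestDecision x hx c hc).imp (·.mono hsent) (·.mono hsent)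
  · obtain rfl := List.mem_singleton.1 hx
    obtain ⟨p, -, hj, hv⟩ := hc
    exact ⟨hj.mono ((h.received_subset p).trans hsent), hv.mono ((h.received_subset p).trans hsent)⟩

/-- The invariant does not depend on the decided values, and messages can be received. -/
theorem Invariant.of_sent_eq (h : Invariant f faulty E s) (a : Action P V) {s' : State P V}
    (hsent : s'.sent = s.sent) (hround : s'.round = s.round)
    (hrec : ∀ p, s'.received p ⊆ s.sent) : Invariant f faulty (E ++ [(s, a)]) s' where
  received_subset := by rwa [hsent]
  embedded_subset := by rw [hsent]; exact h.embedded_subset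
  join_justified := by rw [hsent]; exact h.join_justified
  join_unique := by rw [hsent]; exact h.join_unique
  vote_correct := by rw [hsent, hround]; exact h.vote_correct
  roundChange_le := by rw [hsent, hround]; exact h.roundChange_le
  report_noVote := by rw [hsent]; exact h.report_noVote
  report_voted := by rw [hsent]; exact h.report_voted
  vote_honest w hw hc := by
    obtain ⟨x, hx, hv⟩ := h.vote_honest w (hsent ▸ hw) hc
    exact ⟨x, List.mem_append_left _ hx, hv⟩
  joins_of_honestVote := (h.concat a hsent.ge).1
  quorums_of_honestDecision := (h.concat a hsent.ge).2

/-! ### Preservation of the invariant by sending -/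

/-- The condition under which the process `p` may send the message `m`. -/
def MaySend (f : ℕ) (faulty : Finset P) (leader : ℕ → P) (s : State P V) (p : P)
    (m : Msg P V) : Prop :=
  (p ∈ faulty → m.embedded ⊆ s.received p) ∧ (p ∉ faulty → CorrectSend f leader s p m)

variable {leader : ℕ → P} {p : P}

/-- Faulty senders cannot forge, and correct ones pass on only what they received or, in a
ROUND-CHANGE, a vote of their own. -/
theorem Invariant.embedded_subset_of_maySend (h : Invariant f faulty E s) {m : Msg P V}
    (hm : MaySend f faulty leader s p m) : m.embedded ⊆ s.sent := by
  by_cases hp : p ∈ faulty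
  · exact (hm.1 hp).trans (h.received_subset p)
  have hc := hm.2 hp
  cases m with
  | propose m =>
    rintro _ ⟨rc, hrc, rfl⟩
    exact h.received_subset p (hc.2.2 rc hrc)
  | join j => exact Set.empty_subset _
  | vote w =>
    rintro _ ⟨j, hj, rfl⟩
    exact h.received_subset p (hc.2.2.2 j hj)
  | roundChange rc =>
    rintro _ ⟨sn, w, hw, rfl⟩
    have := hc.2 sn
    rw [hw] at this
    exact this.1

/-- This makes every certified vote honest, even that of a faulty process: it must have received the
JOINs of the certificate before sending. -/
theorem joinQuorum_received_of_maySend {w : Vote P V}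
    (hm : MaySend f faulty leader s p (.vote w)) (hw : Certified f w) :
    JoinQuorum f (s.received p) w.content := by
  refine JoinQuorum.mono hw ?_
  by_cases hp : p ∈ faulty
  · exact hm.1 hp
  · rintro _ ⟨j, hj, rfl⟩
    exact (hm.2 hp).2.2.2 j hj

theorem round_le_afterSend {m : Msg P V} (hm : MaySend f faulty leader s p m) {q : P}
    (hq : q ∉ faulty) : s.round q ≤ (afterSend s p m).round q := by
  classical
  cases m with
  | roundChange rc =>
    simp only [afterSend]
    rcases eq_or_ne q p with rfl | hne
    · rw [Function.update_self, (hm.2 hq).1]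
      exact Nat.le_succ _
    · rw [Function.update_of_ne hne]
  | _ => exact le_rfl

/-- Reports stay accurate because rounds of correct processes never decrease: a vote sent after
ROUND-CHANGE for round `r` has round at least `r`, which is the exception allowed in `report_noVote`
and `report_voted`. -/
theorem Invariant.send (h : Invariant f faulty E s) {m : Msg P V} (hp : m.sender = p)
    (hm : MaySend f faulty leader s p m) :
    Invariant f faulty (E ++ [(s, .send p m)]) (afterSend s p m) where
  received_subset q := (h.received_subset q).trans (Set.subset_insert _ _)
  embedded_subset m' hm' := by
    refine Set.Subset.trans ?_ (Set.subset_insert m s.sent)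
    rcases hm' with rfl | hm'
    · exact h.embedded_subset_of_maySend hm
    · exact h.embedded_subset m' hm'
  join_justified j hj hc := by
    suffices hex : ∃ cert, Justified f j.content cert ∧
        ∀ rc ∈ cert, Msg.roundChange rc ∈ s.sent by
      obtain ⟨cert, h1, h2⟩ := hex
      exact ⟨cert, h1, fun rc hrc => Or.inr (h2 rc hrc)⟩
    rcases hj with rfl | hj
    · obtain rfl : j.sender = p := hp
      obtain ⟨-, -, m, hrec, -, hcont, hjust⟩ := hm.2 hc
      -- The justifying ROUND-CHANGE messages are embedded in a PROPOSE that was received, hence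
      -- they have been sent.
      exact ⟨m.cert, hcont ▸ hjust, fun rc hrc =>
        h.embedded_subset _ (h.received_subset _ hrec) ⟨rc, hrc, rfl⟩⟩
    · exact h.join_justified j hj hc
  join_unique j j' hj hj' hc hs hr hn := by
    rcases hj with rfl | hj <;> rcases hj' with hj' | hj'
    · cases hj'
      rfl
    · obtain rfl : j.sender = p := hp
      exact absurd ⟨hr.symm, hn.symm⟩ ((hm.2 hc).2.1 j' hj' hs)
    · subst hj'
      obtain rfl : j'.sender = p := hp
      rw [hs] at hm
      exact absurd ⟨hr, hn⟩ ((hm.2 hc).2.1 j hj rfl)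
    · exact h.join_unique j j' hj hj' hc hs hr hn
  vote_correct w hw hc := by
    rcases hw with rfl | hw
    · obtain rfl : w.sender = p := hp
      obtain ⟨hr, -, hcert, -⟩ := hm.2 hc
      exact ⟨hr.le, hcert⟩
    · obtain ⟨hr, hcert⟩ := h.vote_correct w hw hc
      exact ⟨hr.trans (round_le_afterSend hm hc), hcert⟩
  roundChange_le rc hrc hc := by
    rcases hrc with rfl | hrc
    · obtain rfl : rc.sender = p := hp
      simp [afterSend]
    · exact (h.roundChange_le rc hrc hc).trans (round_le_afterSend hm hc)
  report_noVote rc sn hrc hc hrep w hw hs hn := by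
    rcases hrc with rfl | hrc
    · obtain rfl : rc.sender = p := hp
      rcases hw with hw | hw
      · cases hw
      · have := (hm.2 hc).2 sn
        rw [hrep] at this
        exact absurd hn (this w hw hs)
    · rcases hw with rfl | hw
      · obtain rfl : w.sender = p := hp
        rw [hs] at hm
        exact (h.roundChange_le rc hrc hc).trans (hm.2 hc).1.ge
      · exact h.report_noVote rc sn hrc hc hrep w hw hs hn
  report_voted rc sn w hrc hc hrep := by
    rcases hrc with rfl | hrc
    · obtain rfl : rc.sender = p := hp
      obtain ⟨hr, hall⟩ := hm.2 hc
      have hsn := hall sn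
      rw [hrep] at hsn
      obtain ⟨hw, hs, hn, hmax⟩ := hsn
      obtain ⟨hle, hcert⟩ := h.vote_correct w hw (hs ▸ hc)
      refine ⟨⟨hrep, hs, hn, ?_, hcert⟩, fun w' hw' hs' hn' => Or.inl ?_⟩
      -- The reported vote is from a round at most the current one, and the ROUND-CHANGE is for the
      -- next.
      · rw [hs] at hle
        omega
      · rcases hw' with hw' | hw'
        · cases hw'
        · exact hmax w' hw' hs' hn'
    · obtain ⟨h1, h2⟩ := h.report_voted rc sn w hrc hc hrep
      refine ⟨h1, fun w' hw' hs hn => ?_⟩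
      rcases hw' with rfl | hw'
      · obtain rfl : w'.sender = p := hp
        rw [hs] at hm
        exact Or.inr ((h.roundChange_le rc hrc hc).trans (hm.2 hc).1.ge)
      · exact h2 w' hw' hs hn
  vote_honest w hw hcert := by
    rcases hw with rfl | hw
    · exact ⟨_, List.mem_append_right _ (List.mem_singleton_self _), p, w, rfl, rfl,
        joinQuorum_received_of_maySend hm hcert⟩
    · obtain ⟨x, hx, hv⟩ := h.vote_honest w hw hcert
      exact ⟨x, List.mem_append_left _ hx, hv⟩
  joins_of_honestVote := (h.concat _ (Set.subset_insert _ _)).1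
  quorums_of_honestDecision := (h.concat _ (Set.subset_insert _ _)).2

theorem Invariant.of_execution (hE : (lts (V := V) f faulty leader).Execution E s) :
    Invariant f faulty E s := by
  induction hE with
  | nil => exact Invariant.init
  | @snoc E s s' a _ hTr h =>
    classical
    cases a with
    | receive p m =>
      obtain ⟨hm, rfl⟩ := hTr
      refine h.of_sent_eq _ rfl rfl fun q => ?_
      rcases eq_or_ne q p with rfl | hne
      · simpa using Set.insert_subset hm (h.received_subset q)
      · simpa [Function.update_of_ne hne] using h.received_subset q
    | send p m =>
      obtain ⟨hp, hm, rfl⟩ := hTr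
      exact h.send (leader := leader) hp
        ⟨fun hf => by simpa only [if_pos hf] using hm,
          fun hf => by simpa only [if_neg hf] using hm⟩
    | decide p c =>
      obtain ⟨-, rfl⟩ := hTr
      exact h.of_sent_eq _ rfl rfl h.received_subset

/-! ### Agreement -/

/-- A correct process common to both quorums has sent only one JOIN for this round and sequence
number. -/
theorem Invariant.eq_of_joinQuorum [Fintype P] (hP : Fintype.card P = 3 * f + 1)
    (hfaulty : faulty.card ≤ f) (h : Invariant f faulty E s) {c d : Content V}
    (hc : JoinQuorum f s.sent c) (hd : JoinQuorum f s.sent d) (hr : c.round = d.round)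
    (hn : c.sn = d.sn) : c = d := by
  obtain ⟨S, hS, hc⟩ := hc
  obtain ⟨T, hT, hd⟩ := hd
  obtain ⟨p, hpS, hpT, hp⟩ := exists_correct_of_two_quorums hP hfaulty hS hT
  exact h.join_unique ⟨p, c⟩ ⟨p, d⟩ (hc p hpS) (hd p hpT) hp rfl hr hn

/-- A proposal joined by a quorum selects no vote older than one on which a quorum agreed. -/
theorem Invariant.round_le_src [Fintype P] (hP : Fintype.card P = 3 * f + 1)
    (hfaulty : faulty.card ≤ f) (h : Invariant f faulty E s) {c d : Content V}
    (hc : VoteQuorum f s.sent c) (hd : JoinQuorum f s.sent d) (hn : c.sn = d.sn)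
    (hr : c.round < d.round) : c.round ≤ d.src := by
  obtain ⟨S, hS, hd⟩ := hd
  obtain ⟨q, hqS, hq⟩ := exists_correct_of_quorum hfaulty hS
  obtain ⟨cert, hjust, hsent⟩ := h.join_justified ⟨q, d⟩ (hd q hqS) hq
  rcases hjust with ⟨h1, -⟩ | ⟨-, hround, ⟨T, hT, hTc⟩, hsel⟩
  · dsimp only at h1
    -- In round 1 there is no selection, but then `c.round = 0` and the bound is trivial.
    omega
  obtain ⟨U, hU, hc⟩ := hc
  -- A correct `p` voted for `c` and also contributed to the certificate of `d`. Its report cannot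
  -- be `noVote`, and a reported vote has round at least `c.round`, which bounds the maximum
  -- selected.
  obtain ⟨p, hpT, hpU, hp⟩ := exists_correct_of_two_quorums hP hfaulty hT hU
  obtain ⟨rc, hrc, rfl⟩ := hTc p hpT
  obtain ⟨w, hws, rfl, hw⟩ := hc _ hpU
  obtain ⟨hrr, hna⟩ := hround rc hrc
  cases hrep : rc.report d.sn with
  | agreed => exact absurd hrep hna
  | noVote =>
    have := h.report_noVote rc d.sn (hsent rc hrc) hp hrep w hw hws hn
    dsimp only at hrr
    omega
  | voted w₀ =>
    obtain ⟨hval, hmax⟩ := h.report_voted rc d.sn w₀ (hsent rc hrc) hp hrep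
    have hle := hmax w hw hws hn
    rcases hsel with ⟨-, hnone⟩ | ⟨_, _, _, _, -, -, hsrc⟩
    · exact absurd hval (hnone rc hrc w₀)
    · have := hsrc rc hrc w₀ hval
      dsimp only at hrr this
      omega

/-- The selected vote of a proposal joined by a quorum was sent honestly. -/
theorem Invariant.exists_source (hfaulty : faulty.card ≤ f) (h : Invariant f faulty E s)
    {d : Content V} (hd : JoinQuorum f s.sent d) :
    0 < d.round ∧ (0 < d.src → d.src < d.round ∧
      ∃ p, ∃ x ∈ E, HonestVote f x ⟨d.src, d.sn, d.value, p⟩) := by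
  obtain ⟨S, hS, hd⟩ := hd
  obtain ⟨q, hqS, hq⟩ := exists_correct_of_quorum hfaulty hS
  obtain ⟨cert, hjust, hsent⟩ := h.join_justified ⟨q, d⟩ (hd q hqS) hq
  dsimp only at hjust
  rcases hjust with ⟨h1, h2⟩ | ⟨h1, hround, -, hsel⟩
  · exact ⟨by omega, fun h0 => by omega⟩
  refine ⟨by omega, fun h0 => ?_⟩
  rcases hsel with ⟨h2, -⟩ | ⟨rc, hrc, w, ⟨hrep, -, hn, hlt, hcert⟩, hr, hv, -⟩
  · omega
  -- The ROUND-CHANGE may come from a faulty process; the vote inside it was still sent, and being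
  -- certified it was sent honestly.
  have hw : Msg.vote w ∈ s.sent :=
    h.embedded_subset _ (hsent rc hrc) ⟨_, w, hrep, rfl⟩
  refine ⟨by rw [← hr, ← (hround rc hrc).1]; exact hlt, w.content.src, ?_⟩
  rw [← hr, ← hn, ← hv]
  exact h.vote_honest w hw hcert

/-- The quorum contains a correct voter, and correct processes send only certified votes. This is
why a commit comes after its add. -/
theorem Invariant.exists_honestVote (hfaulty : faulty.card ≤ f) (h : Invariant f faulty E s)
    {c : Content V} (hc : VoteQuorum f s.sent c) : ∃ x ∈ E, HonestVote f x c := by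
  obtain ⟨S, hS, hc⟩ := hc
  obtain ⟨q, hqS, hq⟩ := exists_correct_of_quorum hfaulty hS
  obtain ⟨w, rfl, rfl, hw⟩ := hc q hqS
  exact h.vote_honest w hw (h.vote_correct w hw hq).2

/-! ### Linearization -/

theorem linearizeFrom_append_singleton (past L : List (State P V × Action P V))
    (x : State P V × Action P V) : linearizeFrom f past (L ++ [x]) =
      linearizeFrom f past L ++ (linearizationPoint f (past ++ L) x).toList := by
  induction L generalizing past with
  | nil => simp [linearizeFrom]
  | cons y L ih => simp [linearizeFrom, ih]

theorem onInstance_linearize_append_singleton (sn : ℕ) (x : State P V × Action P V) :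
    onInstance sn (linearize f (E ++ [x])) =
      onInstance sn (linearize f E) ++ onInstance sn (linearizationPoint f E x).toList := by
  rw [linearize, linearizeFrom_append_singleton, QTree.onInstance_append, List.nil_append]
  rfl

theorem onInstance_toList (sn : ℕ) (o : Option (ℕ × QTree.Invocation V)) :
    (onInstance sn o.toList = [] ∧ ∀ i, o ≠ some (sn, i)) ∨
      ∃ i, o = some (sn, i) ∧ onInstance sn o.toList = [i] := by
  rcases o with _ | ⟨k, i⟩
  · simp [onInstance]
  · rcases eq_or_ne k sn with rfl | hne
    · simp [onInstance]
    · simp [onInstance, hne]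

theorem mem_onInstance_linearize {sn : ℕ} {x : State P V × Action P V} {i : QTree.Invocation V} :
    i ∈ onInstance sn (linearize f (E ++ [x])) ↔
      i ∈ onInstance sn (linearize f E) ∨ linearizationPoint f E x = some (sn, i) := by
  rw [onInstance_linearize_append_singleton, List.mem_append]
  refine or_congr_right ?_
  rcases onInstance_toList sn (linearizationPoint f E x) with ⟨h, h'⟩ | ⟨i', h, h'⟩
  · simp [h, h']
  · simp [h, onInstance, eq_comm]

theorem linearizationPoint_eq_add {x : State P V × Action P V} {sn r p : ℕ} {v : V}
    (h : linearizationPoint f E x = some (sn, .add r v p)) :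
    HonestVote f x ⟨r, sn, v, p⟩ ∧
      ∀ y ∈ E, ∀ c, HonestVote f y c → ¬ (c.round = r ∧ c.sn = sn) := by
  unfold linearizationPoint at h
  split at h
  · split_ifs at h with hc
    simp only [Option.some.injEq, Prod.mk.injEq, QTree.Invocation.add.injEq] at h
    obtain ⟨rfl, rfl, rfl, rfl⟩ := h
    exact hc
  · split_ifs at h
    simp at h
  · cases h

theorem linearizationPoint_eq_commit {x : State P V × Action P V} {sn r : ℕ}
    (h : linearizationPoint f E x = some (sn, .commit r)) :
    (∃ d : Content V, d.round = r ∧ d.sn = sn ∧ HonestDecision f x d) ∧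
      ∀ y ∈ E, ∀ c, HonestDecision f y c → ¬ (c.round = r ∧ c.sn = sn) := by
  unfold linearizationPoint at h
  split at h
  · split_ifs at h
    simp at h
  · split_ifs at h with hc
    simp only [Option.some.injEq, Prod.mk.injEq, QTree.Invocation.commit.injEq] at h
    obtain ⟨rfl, rfl⟩ := h
    exact ⟨⟨_, rfl, rfl, hc.1⟩, hc.2⟩
  · cases h

theorem linearizationPoint_of_honestVote {x : State P V × Action P V} {c : Content V}
    (hx : HonestVote f x c)
    (hfirst : ∀ y ∈ E, ∀ d, HonestVote f y d → ¬ (d.round = c.round ∧ d.sn = c.sn)) :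
    linearizationPoint f E x = some (c.sn, .add c.round c.value c.src) := by
  obtain ⟨s, a⟩ := x
  have hx' := hx
  obtain ⟨p, w, rfl, rfl, -⟩ := hx
  exact if_pos ⟨hx', hfirst⟩

/-- The added nodes are the contents of honest votes. -/
theorem exists_honestVote_of_add_mem (E : List (State P V × Action P V)) {sn r p : ℕ} {v : V}
    (h : QTree.Invocation.add r v p ∈ onInstance sn (linearize f E)) :
    ∃ x ∈ E, HonestVote f x ⟨r, sn, v, p⟩ := by
  induction E using List.reverseRecOn with
  | nil => simp [linearize, linearizeFrom, onInstance] at h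
  | append_singleton E x ih =>
    rcases mem_onInstance_linearize.1 h with h | h
    · obtain ⟨y, hy, hv⟩ := ih h
      exact ⟨y, List.mem_append_left _ hy, hv⟩
    · exact ⟨x, by simp, (linearizationPoint_eq_add h).1⟩

theorem exists_honestDecision_of_commit_mem (E : List (State P V × Action P V)) {sn r : ℕ}
    (h : QTree.Invocation.commit r ∈ onInstance sn (linearize f E)) :
    ∃ d : Content V, d.round = r ∧ d.sn = sn ∧ ∃ x ∈ E, HonestDecision f x d := by
  induction E using List.reverseRecOn with
  | nil => simp [linearize, linearizeFrom, onInstance] at h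
  | append_singleton E x ih =>
    rcases mem_onInstance_linearize.1 h with h | h
    · obtain ⟨d, h1, h2, y, hy, hv⟩ := ih h
      exact ⟨d, h1, h2, y, List.mem_append_left _ hy, hv⟩
    · obtain ⟨⟨d, h1, h2, hd⟩, -⟩ := linearizationPoint_eq_commit h
      exact ⟨d, h1, h2, x, by simp, hd⟩

/-- The add is placed at the first honest vote for this round and sequence number, whose value and
source could a priori differ; agreement removes the ambiguity in `Invariant.add_mem_of_honestVote`.
-/
theorem exists_add_mem_of_honestVote (E : List (State P V × Action P V)) {c : Content V}
    (h : ∃ x ∈ E, HonestVote f x c) :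
    ∃ v p, QTree.Invocation.add c.round v p ∈ onInstance c.sn (linearize f E) := by
  induction E using List.reverseRecOn generalizing c with
  | nil => simp at h
  | append_singleton E x ih =>
    by_cases hE : ∃ y ∈ E, ∃ d, HonestVote f y d ∧ d.round = c.round ∧ d.sn = c.sn
    · obtain ⟨y, hy, d, hd, hr, hn⟩ := hE
      obtain ⟨v, p, hm⟩ := ih ⟨y, hy, hd⟩
      rw [hr, hn] at hm
      exact ⟨v, p, mem_onInstance_linearize.2 (Or.inl hm)⟩
    · push Not at hE
      obtain ⟨y, hy, hv⟩ := h
      rcases List.mem_append.1 hy with hy | hy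
      · exact absurd rfl (hE y hy c hv rfl)
      · obtain rfl := List.mem_singleton.1 hy
        exact ⟨_, _, mem_onInstance_linearize.2 (Or.inr
          (linearizationPoint_of_honestVote hv fun z hz d hd hrn => hE z hz d hd hrn.1 hrn.2))⟩

theorem Invariant.add_mem_of_honestVote [Fintype P] (hP : Fintype.card P = 3 * f + 1)
    (hfaulty : faulty.card ≤ f) (h : Invariant f faulty E s) {c : Content V}
    (hc : ∃ x ∈ E, HonestVote f x c) :
    QTree.Invocation.add c.round c.value c.src ∈ onInstance c.sn (linearize f E) := by
  obtain ⟨v, p, hm⟩ := exists_add_mem_of_honestVote E hc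
  obtain ⟨x, hx, hv⟩ := hc
  obtain ⟨y, hy, hv'⟩ := exists_honestVote_of_add_mem E hm
  have := h.eq_of_joinQuorum hP hfaulty (h.joins_of_honestVote x hx c hv)
    (h.joins_of_honestVote y hy _ hv') rfl rfl
  rw [this] at hm ⊢
  exact hm

/-- No node skips the round of a committed one. -/
theorem Invariant.no_commit [Fintype P] (hP : Fintype.card P = 3 * f + 1)
    (hfaulty : faulty.card ≤ f) (h : Invariant f faulty E s) {sn r r' r'' : ℕ} {v : V}
    (hadd : QTree.Invocation.add r' v r'' ∈ onInstance sn (linearize f E)) (h1 : r'' < r)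
    (h2 : r < r') : QTree.Invocation.commit r ∉ onInstance sn (linearize f E) := by
  intro hcommit
  obtain ⟨d, rfl, rfl, x, hx, hd⟩ := exists_honestDecision_of_commit_mem E hcommit
  obtain ⟨y, hy, hv⟩ := exists_honestVote_of_add_mem E hadd
  have := h.round_le_src hP hfaulty (h.quorums_of_honestDecision x hx d hd).2
    (h.joins_of_honestVote y hy _ hv) rfl h2
  dsimp only at this
  omega

/-- Two invariants are used at each step: the one before it shows that what the new invocation
relies on was linearized strictly earlier, and the one after it excludes skipped commits, with the
new invocation included. -/
theorem goodSequence_of_execution [Fintype P] (hP : Fintype.card P = 3 * f + 1)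
    (hfaulty : faulty.card ≤ f) (hE : (lts (V := V) f faulty leader).Execution E s) (sn : ℕ) :
    QTree.GoodSequence (onInstance sn (linearize f E)) := by
  induction hE with
  | nil => exact QTree.GoodSequence.nil
  | @snoc E s s' a hE hTr ih =>
    have h := Invariant.of_execution hE
    have h' := Invariant.of_execution (hE.snoc hTr)
    have hno := fun (k k' k'' : ℕ) (w w' : V) (p' : ℕ)
        (_ : QTree.Invocation.add k w p' ∈ onInstance sn (linearize f (E ++ [(s, a)]))) hadd h1 h2 =>
      h'.no_commit hP hfaulty (sn := sn) (r := k) (r' := k') (r'' := k'') (v := w') hadd h1 h2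
    rw [onInstance_linearize_append_singleton] at hno ⊢
    rcases onInstance_toList sn (linearizationPoint f E (s, a)) with ⟨h0, -⟩ | ⟨i, hi, h0⟩
    · rwa [h0, List.append_nil]
    rw [h0] at hno ⊢
    cases i with
    | add r v p =>
      obtain ⟨hv, hfirst⟩ := linearizationPoint_eq_add hi
      refine ih.concat_add (fun v' p' hm => ?_) (fun hp => ?_) hno
      · obtain ⟨y, hy, hv'⟩ := exists_honestVote_of_add_mem E hm
        exact hfirst y hy _ hv' ⟨rfl, rfl⟩
      -- The JOINs behind an honest vote were received before it, so the source vote they rest on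
      -- already lies in `E`.
      · obtain ⟨q, w, -, -, hq⟩ := hv
        obtain ⟨hlt, p', hx⟩ :=
          (h.exists_source hfaulty (hq.mono (h.received_subset q))).2 hp
        exact ⟨hlt, p', h.add_mem_of_honestVote hP hfaulty hx⟩
    | commit r =>
      obtain ⟨⟨d, rfl, rfl, hd⟩, hfirst⟩ := linearizationPoint_eq_commit hi
      refine ih.concat_commit (fun hm => ?_) ?_ hno
      · obtain ⟨d', hr, hn, y, hy, hd'⟩ := exists_honestDecision_of_commit_mem E hm
        exact hfirst y hy d' hd' ⟨hr, hn⟩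
      · obtain ⟨q, -, -, hq⟩ := hd
        exact exists_add_mem_of_honestVote E
          (h.exists_honestVote hfaulty (hq.mono (h.received_subset q)))

end PBFT

theorem mainTheorem6 {P V : Type*} [Fintype P] (f : ℕ) (hP : Fintype.card P = 3 * f + 1)
    (faulty : Finset P) (hfaulty : faulty.card ≤ f) (leader : ℕ → P) :
    -- PBFT refines the composition of independent instances
    (PBFT.lts (V := V) f faulty leader).Refines (QTree.composition V) (PBFT.gamma f) ∧
    ∀ E s, (PBFT.lts (V := V) f faulty leader).Execution E s →
      -- on each instance, the linearized invocations have the four properties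
      (∀ sn, QTree.GoodSequence (PBFT.onInstance sn (PBFT.linearize f E))) ∧
      -- all honest votes and decisions for the same round and sequence number agree
      (∀ x ∈ E, ∀ y ∈ E, ∀ c d : PBFT.Content V,
        (PBFT.HonestVote f x c ∨ PBFT.HonestDecision f x c) →
        (PBFT.HonestVote f y d ∨ PBFT.HonestDecision f y d) →
        c.round = d.round → c.sn = d.sn → c = d) := by
  refine ⟨fun E s hE => ?_, fun E s hE => ⟨PBFT.goodSequence_of_execution hP hfaulty hE, ?_⟩⟩
  · have h := PBFT.Invariant.of_execution hE
    refine QTree.mem_traces_composition (PBFT.goodSequence_of_execution hP hfaulty hE) ?_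
    intro sn r v p hm
    obtain ⟨x, hx, hv⟩ := PBFT.exists_honestVote_of_add_mem E hm
    -- Positivity of rounds is not part of `GoodSequence`; it comes from the justification of a
    -- joined proposal.
    exact (h.exists_source hfaulty (h.joins_of_honestVote x hx _ hv)).1
  · intro x hx y hy c d hc hd
    have h := PBFT.Invariant.of_execution hE
    have key : ∀ x ∈ E, ∀ c, PBFT.HonestVote f x c ∨ PBFT.HonestDecision f x c →
        PBFT.JoinQuorum f s.sent c := by
      rintro x hx c (hc | hc)
      · exact h.joins_of_honestVote x hx c hc
      · exact (h.quorums_of_honestDecision x hx c hc).1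
    exact h.eq_of_joinQuorum hP hfaulty (key x hx c hc) (key y hy d hd)
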